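/- A plain machine is a partial computable function $U$ that maps a pair $(p,y)$ of binary strings (a program $p$ and a condition $y$) to a binary string, and the plain Kolmogorov complexity relative to $U$ is $C_U(x\mid y)=\min\{|p| : U(p,y)=x\}$ (infinite if there is no such $p$). Let $U$ be an optimal plain machine, that is, for every plain machine $V$ there is a constant $d$ with $C_U(x\mid y)\le C_V(x\mid y)+d$ for all strings $x,y$. Write $C(x\mid y)=C_U(x\mid y)$ and $C(x)=C(x\mid \text{empty string})$, and identify natural numbers with their binary representations. Then there is a constant $c$ (depending only on $U$) such that for every $n$ there is a binary string $x$ of length $n$ with $$C(C(x)\mid x)\ \ge\ \log_2 n-c .$$ -/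

import Mathlib

/-- The plain conditional complexity `C_U(x | y) = min { |p| : U(p, y) = x }` of the binary string
`x` given the binary string `y`, relative to the machine `U`, where `U p y` is the (possibly
undefined) output of `U` on program `p` and condition `y`.
Its value is `⊤` if no program works. -/
noncomputable def plainComplexity (U : List Bool → List Bool →. List Bool)
    (x y : List Bool) : ℕ∞ :=
  ⨅ p ∈ {p : List Bool | x ∈ U p y}, (p.length : ℕ∞)

/-- `U` is a plain machine (a partial computable function of program and condition) whose
complexity is minimal, up to an additive constant, among all plain machines. -/
def IsOptimalMachine (U : List Bool → List Bool →. List Bool) : Prop :=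
  Partrec₂ U ∧
    ∀ V : List Bool → List Bool →. List Bool, Partrec₂ V →
      ∃ d : ℕ, ∀ x y : List Bool, plainComplexity U x y ≤ plainComplexity V x y + d

/-! The proof is a game against `U`. Suppose that every `x` of length `n` has `C(C(x) | x) < r`,
where `2 ^ r` is of order `n`. Call `k` dead for `x` if it has a program shorter than `r` given `x`.
Each `x` has fewer than `2 ^ r` dead values, and `C(x)` is one of them. Take the lengths `M * j`
with `J ≤ j < 2 * J`, `J = 2 ^ (r + 1)`, as rows. From the top row down, a machine `V` describes
strings not known to have complexity at most `M * j`. This forces `C(x) ≤ M * j`, so `C(x)` is a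
dead value below those counted so far. One dead value is gained per row, and `2 ^ r` rows give a
contradiction (`lightAbove_lt`).

The opponent can spoil a row by making too many strings of length `n` simple; such heavy rows are
skipped. Playing with a share `2 ^ (-s)` of the descriptions makes a row heavy only if that share of
all programs was spent on length `n`. A program outputs a string of only one length, so the shares
of all started games add up to a constant (`sum_active_le`), while a suitable `s` leaves half of the
rows light (`exists_active_balanced`).

`V` must be fixed before its constant `d` is known, so it plays for all `d` at once with weights `2
^ (-(d + 5))` (`sum_budget_le`); the spacing `M = 2 * d + 7` absorbs this loss.
`exists_machine_of_capped` turns requests with quotas into a machine. -/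

/-- The binary strings of length `n`. -/
def strs : ℕ → List (List Bool)
  | 0 => [[]]
  | n + 1 => (strs n).map (List.cons false) ++ (strs n).map (List.cons true)

/-- The binary strings of length less than `n`. -/
def shortStrs : ℕ → List (List Bool)
  | 0 => []
  | n + 1 => shortStrs n ++ strs n

theorem mem_strs {n : ℕ} {x : List Bool} : x ∈ strs n ↔ x.length = n := by
  induction n generalizing x with
  | zero => simp [strs]
  | succ n ih =>
    rcases x with _ | ⟨b, x⟩
    · simp [strs]
    · cases b <;> simp [strs, ih]

theorem nodup_strs (n : ℕ) : (strs n).Nodup := by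
  induction n with
  | zero => simp [strs]
  | succ n ih =>
    refine List.Nodup.append (ih.map (List.cons_injective)) (ih.map (List.cons_injective)) ?_
    intro x hx hx'
    simp only [List.mem_map] at hx hx'
    obtain ⟨a, -, rfl⟩ := hx
    obtain ⟨b, -, h⟩ := hx'
    simp at h

theorem length_strs (n : ℕ) : (strs n).length = 2 ^ n := by
  induction n with
  | zero => simp [strs]
  | succ n ih => simp [strs, ih, pow_succ, mul_two]

theorem mem_shortStrs {n : ℕ} {x : List Bool} : x ∈ shortStrs n ↔ x.length < n := by
  induction n with
  | zero => simp [shortStrs]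
  | succ n ih => simp [shortStrs, ih, mem_strs]; omega

theorem nodup_shortStrs (n : ℕ) : (shortStrs n).Nodup := by
  induction n with
  | zero => simp [shortStrs]
  | succ n ih =>
    refine List.Nodup.append ih (nodup_strs n) ?_
    intro x hx hx'
    rw [mem_shortStrs] at hx
    rw [mem_strs] at hx'
    omega

theorem length_shortStrs (n : ℕ) : (shortStrs n).length + 1 = 2 ^ n := by
  induction n with
  | zero => simp [shortStrs]
  | succ n ih => simp [shortStrs, length_strs, pow_succ]; omega

theorem primrec_strs : Primrec strs := by
  have h : Primrec₂ fun (_ : ℕ) (l : List (List Bool)) =>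
      l.map (List.cons false) ++ l.map (List.cons true) :=
    Primrec.list_append.comp
      (Primrec.list_map Primrec.snd (Primrec.list_cons.comp (Primrec.const false) Primrec.snd).to₂)
      (Primrec.list_map Primrec.snd (Primrec.list_cons.comp (Primrec.const true) Primrec.snd).to₂)
  refine (Primrec.nat_rec₁ [[]] h).of_eq fun n => ?_
  induction n with
  | zero => rfl
  | succ n ih => simp only [strs, ← ih]

theorem primrec_shortStrs : Primrec shortStrs := by
  have h : Primrec₂ fun (n : ℕ) (l : List (List Bool)) => l ++ strs n :=
    Primrec.list_append.comp Primrec.snd (primrec_strs.comp Primrec.fst)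
  refine (Primrec.nat_rec₁ [] h).of_eq fun n => ?_
  induction n with
  | zero => rfl
  | succ n ih => simp only [shortStrs, ← ih]

/-! ### Enumeration with a quota for each key -/

section CappedEnumeration

variable {K X : Type*} [DecidableEq K] [DecidableEq X] [Primcodable K] [Primcodable X]
  (P : ℕ → K × X → ℕ → Prop) (cap : ℕ → K → ℕ)

open Classical in
/-- One step of the enumeration: append the candidate if it passes the test `P`, is new, and the
quota of its key is not exhausted. -/
noncomputable def capStep (l : ℕ) (R : List (K × X)) (w : (K × X) × ℕ) : List (K × X) :=
  if P l w.1 w.2 ∧ w.1 ∉ R ∧ (R.filter fun v => v.1 = w.1.1).length < cap l w.1.1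
  then R ++ [w.1] else R

/-- The first `m` stages of the enumeration of the pairs passing the test `P`, with at most
`cap l k` pairs of key `k`. -/
noncomputable def capEnum (l : ℕ) : ℕ → List (K × X)
  | 0 => []
  -- Stage `m` tests only the candidate and time coded by `m`, so every candidate is tested at every
  -- time.
  | m + 1 => ((Encodable.decode m : Option ((K × X) × ℕ)).map
      (capStep P cap l (capEnum l m))).getD (capEnum l m)

variable {P cap}

theorem primrec_capEnum (hP : PrimrecPred fun w : ℕ × (K × X) × ℕ => P w.1 w.2.1 w.2.2)
    (hcap : Primrec₂ cap) : Primrec₂ (capEnum P cap) := by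
  classical
  have hmem : PrimrecRel fun (R : List (K × X)) (w : K × X) => w ∈ R :=
    (PrimrecRel.exists_mem_list (Primrec.eq (α := K × X))).of_eq (by simp)
  have hcount : Primrec₂ fun (R : List (K × X)) (k : K) =>
      (R.filter fun v => v.1 = k).length := by
    have h : PrimrecRel fun (v : K × X) (k : K) => v.1 = k :=
      Primrec.eq.comp (Primrec.fst.comp Primrec.fst) Primrec.snd
    exact Primrec.list_length.comp h.listFilter
  have hstep : Primrec fun a : (ℕ × List (K × X)) × ((K × X) × ℕ) =>
      capStep P cap a.1.1 a.1.2 a.2 := by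
    unfold capStep
    have hl : Primrec fun a : (ℕ × List (K × X)) × ((K × X) × ℕ) => a.1.1 :=
      Primrec.fst.comp Primrec.fst
    have hR : Primrec fun a : (ℕ × List (K × X)) × ((K × X) × ℕ) => a.1.2 :=
      Primrec.snd.comp Primrec.fst
    have hw : Primrec fun a : (ℕ × List (K × X)) × ((K × X) × ℕ) => a.2.1 :=
      Primrec.fst.comp Primrec.snd
    have hk : Primrec fun a : (ℕ × List (K × X)) × ((K × X) × ℕ) => a.2.1.1 :=
      Primrec.fst.comp hw
    refine Primrec.ite ?_ (Primrec.list_append.comp hR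
      (Primrec.list_cons.comp hw (Primrec.const []))) hR
    refine PrimrecPred.and ?_ (PrimrecPred.and ?_ ?_)
    · exact hP.comp (hl.pair Primrec.snd)
    · exact (hmem.comp hR hw).not
    · exact Primrec.nat_lt.comp (hcount.comp hR hk) (hcap.comp hl hk)
  have hrec : Primrec₂ fun (l : ℕ) (a : ℕ × List (K × X)) =>
      ((Encodable.decode a.1 : Option ((K × X) × ℕ)).map
        (capStep P cap l a.2)).getD a.2 := by
    refine Primrec.option_getD.comp (Primrec.option_map ?_ ?_) (Primrec.snd.comp Primrec.snd)
    · exact Primrec.decode.comp (Primrec.fst.comp Primrec.snd)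
    · exact hstep.comp (Primrec.pair (Primrec.pair (Primrec.fst.comp Primrec.fst)
        (Primrec.snd.comp (Primrec.snd.comp Primrec.fst))) Primrec.snd)
  refine (Primrec.nat_rec (Primrec.const []) hrec).of_eq fun l m => ?_
  induction m with
  | zero => rfl
  | succ m ih => simp only [capEnum, ← ih]

theorem capEnum_succ (l m : ℕ) :
    capEnum P cap l (m + 1) = capEnum P cap l m ∨
    ∃ w : (K × X) × ℕ, P l w.1 w.2 ∧ w.1 ∉ capEnum P cap l m ∧
      ((capEnum P cap l m).filter fun v => v.1 = w.1.1).length < cap l w.1.1 ∧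
      capEnum P cap l (m + 1) = capEnum P cap l m ++ [w.1] := by
  rw [capEnum]
  rcases (Encodable.decode m : Option ((K × X) × ℕ)) with _ | w
  · simp
  · simp only [Option.map_some, Option.getD_some, capStep]
    split_ifs with h
    · exact Or.inr ⟨w, h.1, h.2.1, h.2.2, rfl⟩
    · exact Or.inl rfl

theorem capEnum_prefix (l : ℕ) {m m' : ℕ} (h : m ≤ m') :
    capEnum P cap l m <+: capEnum P cap l m' := by
  induction h with
  | refl => exact List.prefix_rfl
  | step _ ih =>
    refine ih.trans ?_
    rcases capEnum_succ (P := P) (cap := cap) l _ with h | ⟨w, -, -, -, h⟩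
    · rw [h]
    · rw [h]; exact List.prefix_append _ _

theorem capEnum_spec (l m : ℕ) : (capEnum P cap l m).Nodup ∧
    (∀ w ∈ capEnum P cap l m, ∃ t, P l w t) ∧
    ∀ k, ((capEnum P cap l m).filter fun v => v.1 = k).length ≤ cap l k := by
  induction m with
  | zero => simp [capEnum]
  | succ m ih =>
    obtain ⟨h1, h2, h3⟩ := ih
    rcases capEnum_succ (P := P) (cap := cap) l m with h | ⟨w, hw, hmem, hlt, h⟩
    · rw [h]; exact ⟨h1, h2, h3⟩
    · rw [h]
      refine ⟨?_, ?_, ?_⟩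
      · rw [← List.concat_eq_append]; exact List.Nodup.concat hmem h1
      · intro v hv
        rcases List.mem_append.1 hv with hv | hv
        · exact h2 v hv
        · rw [List.mem_singleton.1 hv]; exact ⟨_, hw⟩
      · intro k
        by_cases hk : w.1.1 = k
        · subst hk; simp; omega
        · simpa [hk] using h3 k

/-- The pair `(w, t)` has its turn at the stage equal to its code. If `w` is not listed by then, its
quota is full, and the growing list preserves either outcome. -/
theorem mem_capEnum_or_full {l : ℕ} {w : K × X} {t : ℕ} (h : P l w t) :
    ∃ m, ∀ m' ≥ m, w ∈ capEnum P cap l m' ∨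
      cap l w.1 ≤ ((capEnum P cap l m').filter fun v => v.1 = w.1).length := by
  set m := Encodable.encode (w, t)
  refine ⟨m + 1, fun m' hm' => ?_⟩
  have hpre := capEnum_prefix (P := P) (cap := cap) l hm'
  have hstep : capEnum P cap l (m + 1) = capStep P cap l (capEnum P cap l m) (w, t) := by
    simp [capEnum, m, Encodable.encodek]
  by_cases hw : w ∈ capEnum P cap l m
  · exact Or.inl ((capEnum_prefix l (by omega : m ≤ m')).subset hw)
  by_cases hc : ((capEnum P cap l m).filter fun v => v.1 = w.1).length < cap l w.1
  · left
    refine hpre.subset ?_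
    rw [hstep, capStep, if_pos ⟨h, hw, hc⟩]
    simp
  · right
    refine (not_lt.1 hc).trans (List.Sublist.length_le ?_)
    exact (capEnum_prefix l (by omega : m ≤ m')).sublist.filter _

/-- At a late stage every element of `S` is listed unless the quota is full; but listing all of `S`
fills the quota too. -/
theorem capEnum_saturates {l : ℕ} {k : K} (S : Finset X) (hS : ∀ x ∈ S, ∃ t, P l (k, x) t)
    (hcard : cap l k ≤ S.card) :
    ∃ m, cap l k ≤ ((capEnum P cap l m).filter fun v => v.1 = k).length := by
  have h : ∀ x ∈ S, ∀ᶠ m in Filter.atTop, (k, x) ∈ capEnum P cap l m ∨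
      cap l k ≤ ((capEnum P cap l m).filter fun v => v.1 = k).length := fun x hx => by
    obtain ⟨t, ht⟩ := hS x hx
    obtain ⟨m, hm⟩ := mem_capEnum_or_full (cap := cap) ht
    exact Filter.eventually_atTop.2 ⟨m, hm⟩
  obtain ⟨m, hm⟩ := ((Filter.eventually_all_finset S).2 h).exists
  refine ⟨m, ?_⟩
  by_contra hlt
  have hsub : S.image (fun x => (k, x)) ⊆
      ((capEnum P cap l m).filter fun v => v.1 = k).toFinset := by
    intro w hw
    obtain ⟨x, hx, rfl⟩ := Finset.mem_image.1 hw
    simpa using (hm x hx).resolve_right hlt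
  have := Finset.card_le_card hsub
  rw [Finset.card_image_of_injective _ (Prod.mk_right_injective k)] at this
  have := this.trans (List.toFinset_card_le _)
  omega

theorem length_capEnum_le {l B : ℕ}
    (hB : ∀ T : Finset K, (∀ k ∈ T, ∃ x t, P l (k, x) t) → ∑ k ∈ T, cap l k ≤ B) (m : ℕ) :
    (capEnum P cap l m).length ≤ B := by
  obtain ⟨h1, h2, h3⟩ := capEnum_spec (P := P) (cap := cap) l m
  set R := capEnum P cap l m
  rw [← List.toFinset_card_of_nodup h1,
    Finset.card_eq_sum_card_image (Prod.fst : K × X → K)]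
  refine (Finset.sum_le_sum fun k _ => ?_).trans (hB (R.toFinset.image Prod.fst) ?_)
  · refine le_trans ?_ (h3 k)
    rw [← List.toFinset_card_of_nodup (h1.filter _)]
    refine Finset.card_le_card fun v hv => ?_
    simpa using hv
  · intro k hk
    obtain ⟨⟨k', x⟩, hw, rfl⟩ := Finset.mem_image.1 hk
    exact ⟨x, h2 _ (List.mem_toFinset.1 hw)⟩

end CappedEnumeration

theorem plainComplexity_le {U : List Bool → List Bool →. List Bool} {p x y : List Bool}
    (h : x ∈ U p y) : plainComplexity U x y ≤ p.length :=
  iInf₂_le p h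

/-- The `i`-th string of length `l` is a program for the `i`-th pair enumerated at level `l`. Lists
only grow at the end, so outputs are stable, and the quotas sum to at most `2 ^ l`, so programs
suffice. Which candidates win is not controlled: `S'` need not lie in `S`. -/
theorem exists_machine_of_capped {K : Type*} [DecidableEq K] [Primcodable K]
    {P : ℕ → K × List Bool → ℕ → Prop} {cap : ℕ → K → ℕ}
    (hP : PrimrecPred fun w : ℕ × (K × List Bool) × ℕ => P w.1 w.2.1 w.2.2)
    (hcap : Primrec₂ cap)
    (hB : ∀ l, ∀ T : Finset K, (∀ k ∈ T, ∃ x t, P l (k, x) t) → ∑ k ∈ T, cap l k ≤ 2 ^ l) :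
    ∃ V : List Bool → List Bool →. List Bool, Partrec₂ V ∧
      ∀ l k, ∀ S : Finset (List Bool), (∀ x ∈ S, ∃ t, P l (k, x) t) → cap l k ≤ S.card →
        ∃ S' : Finset (List Bool), cap l k ≤ S'.card ∧
          ∀ x ∈ S', (∃ t, P l (k, x) t) ∧ ∀ y, plainComplexity V x y ≤ l := by
  let f : List Bool → ℕ → Option (List Bool) := fun p m =>
    ((capEnum P cap p.length m)[(strs p.length).idxOf p]?).map Prod.snd
  have hf : Primrec₂ f := by
    have hsnd : Primrec₂ fun (_ : List Bool × ℕ) (w : K × List Bool) => w.2 :=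
      Primrec.snd.comp Primrec.snd
    have hR : Primrec fun a : List Bool × ℕ => capEnum P cap a.1.length a.2 :=
      (primrec_capEnum hP hcap).comp (Primrec.list_length.comp Primrec.fst) Primrec.snd
    have hi : Primrec fun a : List Bool × ℕ => (strs a.1.length).idxOf a.1 := by
      refine (Primrec.list_idxOf.comp Primrec.fst
        (primrec_strs.comp (Primrec.list_length.comp Primrec.fst))).of_eq fun a => ?_
      congr 1
      exact lawful_beq_subsingleton _ _
    exact Primrec.option_map (Primrec.list_getElem?.comp hR hi) hsnd
  have hmono : ∀ p {a m m'}, m ≤ m' → a ∈ f p m → a ∈ f p m' := by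
    intro p a m m' hm ha
    simp only [f, Option.mem_def, Option.map_eq_some_iff] at ha ⊢
    obtain ⟨w, hw, rfl⟩ := ha
    obtain ⟨t, ht⟩ := capEnum_prefix (P := P) (cap := cap) p.length hm
    obtain ⟨hi, -⟩ := List.getElem?_eq_some_iff.1 hw
    exact ⟨w, by rw [← ht, List.getElem?_append_left hi, hw], rfl⟩
  refine ⟨fun p _ => Nat.rfindOpt (f p), ?_, ?_⟩
  · exact (Partrec.rfindOpt hf.to_comp).comp Computable.fst
  · intro l k S hS hcard
    obtain ⟨m, hm⟩ := capEnum_saturates S hS hcard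
    obtain ⟨h1, h2, -⟩ := capEnum_spec (P := P) (cap := cap) l m
    set R := capEnum P cap l m with hR
    refine ⟨((R.filter fun v => v.1 = k).map Prod.snd).toFinset, ?_, ?_⟩
    · rw [List.toFinset_card_of_nodup, List.length_map]
      · exact hm
      · refine List.Nodup.map_on ?_ (h1.filter _)
        intro v hv v' hv' h
        simp only [List.mem_filter, decide_eq_true_eq] at hv hv'
        exact Prod.ext (hv.2.trans hv'.2.symm) h
    · intro x hx
      have hx : (k, x) ∈ R := by simpa using hx
      refine ⟨h2 _ hx, fun y => ?_⟩
      obtain ⟨i, hi, hix⟩ := List.mem_iff_getElem.1 hx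
      have hlen : i < (strs l).length := by
        rw [length_strs]; exact hi.trans_le (length_capEnum_le (hB l) m)
      have hpl : (strs l)[i].length = l := mem_strs.1 (List.getElem_mem hlen)
      have hidx : (strs l).idxOf (strs l)[i] = i := (nodup_strs l).idxOf_getElem i hlen
      have : x ∈ Nat.rfindOpt (f (strs l)[i]) := by
        rw [Nat.rfindOpt_mono (hmono _)]
        refine ⟨m, ?_⟩
        simp only [f, hpl, hidx, ← hR, List.getElem?_eq_getElem hi, hix]
        rfl
      refine (plainComplexity_le (U := fun p _ => Nat.rfindOpt (f p)) (y := y) this).trans ?_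
      rw [hpl]

/-! ### The game: heavy rows, started games, dead values -/

/-- The natural number with the given binary digits, least significant digit first. -/
def bitsVal (w : List Bool) : ℕ :=
  w.foldr (fun b n => 2 * n + b.toNat) 0

theorem bitsVal_bits (k : ℕ) : bitsVal k.bits = k := by
  induction k using Nat.binaryRec' with
  | zero => simp [bitsVal]
  | bit b n h ih =>
    rw [Nat.bits_append_bit n b h]
    simp only [bitsVal, List.foldr_cons] at ih ⊢
    rw [ih, Nat.bit_val]

theorem primrec_bitsVal : Primrec bitsVal := by
  have h : Primrec₂ fun (_ : List Bool) (a : Bool × ℕ) => 2 * a.2 + a.1.toNat :=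
    Primrec.nat_add.comp
      (Primrec.nat_mul.comp (Primrec.const 2) (Primrec.snd.comp Primrec.snd))
      ((Primrec.dom_bool Bool.toNat).comp (Primrec.fst.comp Primrec.snd))
  exact Primrec.list_foldr Primrec.id (Primrec.const 0) h

/-- The complexity of `x` given `y`, with respect to the finite or limiting evaluator `o`,
is less than `b`. -/
def Below (o : List Bool → List Bool → Option (List Bool)) (b : ℕ) (y x : List Bool) : Prop :=
  ∃ p ∈ shortStrs b, o p y = some x

/-- The number of programs of length less than `b` that output a string of length `n`. -/
def outCount (o : List Bool → List Bool → Option (List Bool)) (n b : ℕ) : ℕ :=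
  ((shortStrs b).filter fun p => (o p []).map List.length = some n).length

/-- At row `M * j`, more than a fraction `2 ^ (-s)` of all programs produce strings of
length `n`. -/
def Heavy (o : List Bool → List Bool → Option (List Bool)) (M n s j : ℕ) : Prop :=
  2 ^ (M * j + 1) ≤ outCount o n (M * j + 1) * 2 ^ s

instance (o : List Bool → List Bool → Option (List Bool)) (M n s j : ℕ) :
    Decidable (Heavy o M n s j) := by unfold Heavy; infer_instance

/-- The number of heavy rows among the rows `J ≤ j < 2 * J`. -/
def heavyCount (o : List Bool → List Bool → Option (List Bool)) (M J n s : ℕ) : ℕ :=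
  ((List.range (2 * J)).filter fun j => J ≤ j ∧ Heavy o M n s j).length

/-- The game for strings of length `n` with budget `2 ^ (-s)` has been started. -/
def Active (o : List Bool → List Bool → Option (List Bool)) (M J n s : ℕ) : Prop :=
  J ≤ 2 * heavyCount o M J n (s + 1) ∨ 4 * M * J ≤ 2 ^ s

/-- The number of rows `i` with `j ≤ i < 2 * J` that are not heavy. -/
def lightAbove (o : List Bool → List Bool → Option (List Bool)) (M J n s j : ℕ) : ℕ :=
  ((List.range (2 * J)).filter fun i => j ≤ i ∧ ¬ Heavy o M n s i).length

/-- The number of `k` with `b ≤ k < B` that have a program of length less than `r` given `x`. -/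
def deadCount (o : List Bool → List Bool → Option (List Bool)) (r B b : ℕ) (x : List Bool) : ℕ :=
  ((List.range B).filter fun k =>
    b ≤ k ∧ ∃ q ∈ shortStrs r, (o q x).map bitsVal = some k).length

/-- The string `x` may be given a description of length `M * j`: it has no such description yet,
and at least as many values above `M * j` are simple given `x` as there are light rows
above `j`. -/
def Eligible (o : List Bool → List Bool → Option (List Bool)) (M J r n s j : ℕ)
    (x : List Bool) : Prop :=
  ¬ Below o (M * j + 1) [] x ∧
    lightAbove o M J n s (j + 1) ≤ deadCount o r (2 * M * J) (M * j + 1) x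

/-! ### Primitive recursiveness of the strategy -/

section Primrec

variable {α β : Type*} [Primcodable α] [Primcodable β]

theorem primrec_filter_length {f : α → List β} {R : α → β → Prop} [∀ a, DecidablePred (R a)]
    (hf : Primrec f) (hR : PrimrecRel R) :
    Primrec fun a => ((f a).filter fun b => R a b).length := by
  have h : PrimrecRel fun (b : β) (a : α) => R a b := hR.swap
  exact Primrec.list_length.comp
    ((PrimrecRel.listFilter h).comp hf Primrec.id)

theorem primrecPred_exists_mem {f : α → List β} {R : α → β → Prop}
    (hf : Primrec f) (hR : PrimrecRel R) : PrimrecPred fun a => ∃ b ∈ f a, R a b := by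
  have h : PrimrecRel fun (b : β) (a : α) => R a b := hR.swap
  exact (PrimrecRel.exists_mem_list h).comp hf Primrec.id

theorem primrec_nat_pow : Primrec₂ ((· ^ ·) : ℕ → ℕ → ℕ) :=
  Primrec₂.unpaired'.1 Nat.Primrec.pow

theorem primrec_log2 : Primrec (Nat.log 2) := by
  -- The logarithm of `n` counts the `k < n` satisfying this relation.
  have hR : PrimrecRel fun (n k : ℕ) => 2 ^ (k + 1) ≤ n :=
    Primrec.nat_le.comp (primrec_nat_pow.comp (Primrec.const 2) (Primrec.succ.comp Primrec.snd))
      Primrec.fst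
  refine (primrec_filter_length Primrec.list_range hR).of_eq fun n => ?_
  rw [← List.toFinset_card_of_nodup (List.nodup_range.filter _)]
  rw [← Finset.card_range (Nat.log 2 n)]
  congr 1
  ext k
  rcases Nat.eq_zero_or_pos n with rfl | hn
  · simp
  · simp only [List.toFinset_filter, List.toFinset_range, decide_eq_true_eq, Finset.mem_filter,
      Finset.mem_range]
    rw [← Nat.le_log_iff_pow_le (by norm_num) hn.ne']
    have := Nat.log_lt_self 2 hn.ne'
    omega

variable {u : ℕ → List Bool → List Bool → Option (List Bool)}

theorem primrecPred_below (hu : Primrec fun a : ℕ × List Bool × List Bool => u a.1 a.2.1 a.2.2)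
    {t b : α → ℕ} {y x : α → List Bool} (ht : Primrec t) (hb : Primrec b) (hy : Primrec y)
    (hx : Primrec x) : PrimrecPred fun a => Below (u (t a)) (b a) (y a) (x a) := by
  refine primrecPred_exists_mem (primrec_shortStrs.comp hb) ?_
  exact Primrec.eq.comp
    (hu.comp ((ht.comp Primrec.fst).pair (Primrec.snd.pair (hy.comp Primrec.fst))))
    (Primrec.option_some.comp (hx.comp Primrec.fst))

theorem primrec_outCount (hu : Primrec fun a : ℕ × List Bool × List Bool => u a.1 a.2.1 a.2.2)
    {t n b : α → ℕ} (ht : Primrec t) (hn : Primrec n) (hb : Primrec b) :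
    Primrec fun a => outCount (u (t a)) (n a) (b a) := by
  have hlen : Primrec₂ fun (_ : α × List Bool) (w : List Bool) => w.length :=
    Primrec.list_length.comp Primrec.snd
  refine primrec_filter_length (primrec_shortStrs.comp hb) ?_
  exact Primrec.eq.comp (Primrec.option_map (hu.comp ((ht.comp Primrec.fst).pair
      (Primrec.snd.pair (Primrec.const [])))) hlen)
    (Primrec.option_some.comp (hn.comp Primrec.fst))

theorem primrecPred_heavy (hu : Primrec fun a : ℕ × List Bool × List Bool => u a.1 a.2.1 a.2.2)
    {t M n s j : α → ℕ} (ht : Primrec t) (hM : Primrec M) (hn : Primrec n) (hs : Primrec s)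
    (hj : Primrec j) : PrimrecPred fun a => Heavy (u (t a)) (M a) (n a) (s a) (j a) := by
  have hb : Primrec fun a => M a * j a + 1 := Primrec.succ.comp (Primrec.nat_mul.comp hM hj)
  exact Primrec.nat_le.comp (primrec_nat_pow.comp (Primrec.const 2) hb)
    (Primrec.nat_mul.comp (primrec_outCount hu ht hn hb)
      (primrec_nat_pow.comp (Primrec.const 2) hs))

theorem primrecPred_active (hu : Primrec fun a : ℕ × List Bool × List Bool => u a.1 a.2.1 a.2.2)
    {t M J n s : α → ℕ} (ht : Primrec t) (hM : Primrec M) (hJ : Primrec J) (hn : Primrec n)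
    (hs : Primrec s) : PrimrecPred fun a => Active (u (t a)) (M a) (J a) (n a) (s a) := by
  have hcount : Primrec fun a => heavyCount (u (t a)) (M a) (J a) (n a) (s a + 1) := by
    refine primrec_filter_length
      (Primrec.list_range.comp (Primrec.nat_mul.comp (Primrec.const 2) hJ)) ?_
    refine PrimrecPred.and (Primrec.nat_le.comp (hJ.comp Primrec.fst) Primrec.snd) ?_
    exact primrecPred_heavy hu (ht.comp Primrec.fst) (hM.comp Primrec.fst) (hn.comp Primrec.fst)
      (Primrec.succ.comp (hs.comp Primrec.fst)) Primrec.snd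
  refine PrimrecPred.or ?_ ?_
  · exact Primrec.nat_le.comp hJ (Primrec.nat_mul.comp (Primrec.const 2) hcount)
  · exact Primrec.nat_le.comp (Primrec.nat_mul.comp (Primrec.nat_mul.comp (Primrec.const 4) hM) hJ)
      (primrec_nat_pow.comp (Primrec.const 2) hs)

theorem primrecPred_eligible
    (hu : Primrec fun a : ℕ × List Bool × List Bool => u a.1 a.2.1 a.2.2)
    {t M J r n s j : α → ℕ} {x : α → List Bool} (ht : Primrec t) (hM : Primrec M)
    (hJ : Primrec J) (hr : Primrec r) (hn : Primrec n) (hs : Primrec s) (hj : Primrec j)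
    (hx : Primrec x) :
    PrimrecPred fun a => Eligible (u (t a)) (M a) (J a) (r a) (n a) (s a) (j a) (x a) := by
  have hb : Primrec fun a => M a * j a + 1 := Primrec.succ.comp (Primrec.nat_mul.comp hM hj)
  have hlight : Primrec fun a => lightAbove (u (t a)) (M a) (J a) (n a) (s a) (j a + 1) := by
    refine primrec_filter_length
      (Primrec.list_range.comp (Primrec.nat_mul.comp (Primrec.const 2) hJ)) ?_
    refine PrimrecPred.and
      (Primrec.nat_le.comp (Primrec.succ.comp (hj.comp Primrec.fst)) Primrec.snd) ?_
    exact (primrecPred_heavy hu (ht.comp Primrec.fst) (hM.comp Primrec.fst) (hn.comp Primrec.fst)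
      (hs.comp Primrec.fst) Primrec.snd).not
  have hdead : Primrec fun a =>
      deadCount (u (t a)) (r a) (2 * M a * J a) (M a * j a + 1) (x a) := by
    refine primrec_filter_length (Primrec.list_range.comp
      (Primrec.nat_mul.comp (Primrec.nat_mul.comp (Primrec.const 2) hM) hJ)) ?_
    refine PrimrecPred.and (Primrec.nat_le.comp (hb.comp Primrec.fst) Primrec.snd) ?_
    refine primrecPred_exists_mem (primrec_shortStrs.comp (hr.comp Primrec.fst)) ?_
    have hval : Primrec₂ fun (_ : (α × ℕ) × List Bool) (w : List Bool) => bitsVal w :=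
      primrec_bitsVal.comp Primrec.snd
    refine Primrec.eq.comp (Primrec.option_map (hu.comp (Primrec.pair ?_ (Primrec.pair
      Primrec.snd ?_))) hval) ?_
    · exact ht.comp (Primrec.fst.comp Primrec.fst)
    · exact hx.comp (Primrec.fst.comp Primrec.fst)
    · exact Primrec.option_some.comp (Primrec.snd.comp Primrec.fst)
  exact PrimrecPred.and (primrecPred_below hu ht hb (Primrec.const []) hx).not
    (Primrec.nat_le.comp hlight hdead)

end Primrec

theorem exists_stepwise_evaluator {U : List Bool → List Bool →. List Bool} (hU : Partrec₂ U) :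
    ∃ u : ℕ → List Bool → List Bool → Option (List Bool),
      Primrec (fun a : ℕ × List Bool × List Bool => u a.1 a.2.1 a.2.2) ∧
      (∀ t t' p y z, t ≤ t' → u t p y = some z → u t' p y = some z) ∧
      ∀ p y z, z ∈ U p y ↔ ∃ t, u t p y = some z := by
  obtain ⟨c, hc⟩ := Nat.Partrec.Code.exists_code.1 hU
  refine ⟨fun t p y => (Nat.Partrec.Code.evaln t c (Encodable.encode (p, y))).bind
    fun k => (Encodable.decode k : Option (List Bool)), ?_, ?_, ?_⟩
  · have hdec : Primrec₂ fun (_ : ℕ × List Bool × List Bool) (k : ℕ) =>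
        (Encodable.decode k : Option (List Bool)) := Primrec.decode.comp Primrec.snd
    refine Primrec.option_bind ?_ hdec
    exact Nat.Partrec.Code.primrec_evaln.comp
      ((Primrec.fst.pair (Primrec.const c)).pair (Primrec.encode.comp Primrec.snd))
  · intro t t' p y z ht h
    simp only [Option.bind_eq_some_iff] at h ⊢
    obtain ⟨k, hk, hz⟩ := h
    exact ⟨k, Nat.Partrec.Code.evaln_mono ht hk, hz⟩
  · intro p y z
    have h : z ∈ U p y ↔ Encodable.encode z ∈ c.eval (Encodable.encode (p, y)) := by
      rw [hc]
      simp
    rw [h, Nat.Partrec.Code.evaln_complete]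
    refine exists_congr fun t => ?_
    simp only [Option.bind_eq_some_iff]
    constructor
    · intro h
      exact ⟨_, h, Encodable.encodek z⟩
    · rintro ⟨k, hk, hz⟩
      -- That `k` decodes to `z` does not by itself make `k` the code of `z`; soundness shows that
      -- `k` is a code.
      have hk' := Nat.Partrec.Code.evaln_sound hk
      rw [hc] at hk'
      simp only [Encodable.encodek, Part.coe_some, Part.bind_some, Part.mem_map_iff] at hk'
      obtain ⟨w, -, rfl⟩ := hk'
      rw [Encodable.encodek, Option.some_inj] at hz
      rwa [← hz]

/-! ### Monotonicity and counting bounds -/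

section Counting

variable {o o' : List Bool → List Bool → Option (List Bool)}

theorem card_filter_toFinset {β : Type*} [DecidableEq β] {l : List β} (hl : l.Nodup)
    (p : β → Prop) [DecidablePred p] :
    (l.filter fun b => p b).length = (l.toFinset.filter p).card := by
  rw [← List.toFinset_card_of_nodup (hl.filter _)]
  congr 1
  ext b
  simp

theorem length_filter_mono {β : Type*} {l : List β} {p q : β → Prop} [DecidablePred p]
    [DecidablePred q] (h : ∀ b ∈ l, p b → q b) :
    (l.filter fun b => p b).length ≤ (l.filter fun b => q b).length := by
  simp only [← List.countP_eq_length_filter]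
  exact List.countP_mono_left fun b hb hp => by simpa using h b hb (by simpa using hp)

theorem Heavy.mono {M n s j : ℕ}
    (ho : ∀ p z, p.length < M * j + 1 → o p [] = some z → o' p [] = some z)
    (h : Heavy o M n s j) : Heavy o' M n s j := by
  refine le_trans h (Nat.mul_le_mul_right _ (length_filter_mono fun p hp hn => ?_))
  obtain ⟨z, hz, hn⟩ := Option.map_eq_some_iff.1 hn
  exact Option.map_eq_some_iff.2 ⟨z, ho _ _ (mem_shortStrs.1 hp) hz, hn⟩

/-- More halting programs only create heavy rows, so a game started at a finite stage stays started
in the limit. -/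
theorem Active.mono {M J n s : ℕ}
    (ho : ∀ p z, p.length < 2 * M * J + 1 → o p [] = some z → o' p [] = some z)
    (h : Active o M J n s) : Active o' M J n s := by
  refine h.imp (fun h => h.trans (Nat.mul_le_mul_left _ ?_)) id
  refine length_filter_mono fun j hj hh => ⟨hh.1, hh.2.mono fun p z hp => ho p z ?_⟩
  have := Nat.mul_le_mul_left M (List.mem_range.1 hj).le
  have : M * (2 * J) = 2 * M * J := by ring
  omega

theorem lightAbove_anti {M J : ℕ}
    (ho : ∀ p z, p.length < 2 * M * J + 1 → o p [] = some z → o' p [] = some z) (n s j : ℕ) :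
    lightAbove o' M J n s j ≤ lightAbove o M J n s j := by
  refine length_filter_mono fun i hi hl =>
    ⟨hl.1, fun h => hl.2 (h.mono fun p z hp => ho p z ?_)⟩
  have := Nat.mul_le_mul_left M (List.mem_range.1 hi).le
  have : M * (2 * J) = 2 * M * J := by ring
  omega

theorem deadCount_mono {r : ℕ} {x : List Bool}
    (ho : ∀ p z, p.length < r → o p x = some z → o' p x = some z) (B b : ℕ) :
    deadCount o r B b x ≤ deadCount o' r B b x := by
  refine length_filter_mono fun k _ hk => ⟨hk.1, ?_⟩
  obtain ⟨q, hq, h⟩ := hk.2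
  obtain ⟨z, hz, hn⟩ := Option.map_eq_some_iff.1 h
  exact ⟨q, hq, Option.map_eq_some_iff.2 ⟨z, ho _ _ (mem_shortStrs.1 hq) hz, hn⟩⟩

/-- A program has one output, so the programs counted for different `n` are disjoint. -/
theorem sum_outCount_le (T : Finset ℕ) (b : ℕ) : ∑ n ∈ T, outCount o n b ≤ 2 ^ b := by
  classical
  have h : ∀ n, outCount o n b =
      ((shortStrs b).toFinset.filter fun p => (o p []).map List.length = some n).card :=
    fun n => card_filter_toFinset (nodup_shortStrs b) _
  simp only [h]
  rw [← Finset.card_biUnion]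
  · refine (Finset.card_le_card (Finset.biUnion_subset.2 fun n _ =>
      Finset.filter_subset _ _)).trans ?_
    rw [List.toFinset_card_of_nodup (nodup_shortStrs b)]
    have := length_shortStrs b
    omega
  · intro n _ m _ hnm
    rw [Function.onFun, Finset.disjoint_left]
    intro p hp hp'
    simp only [Finset.mem_filter] at hp hp'
    exact hnm (Option.some_inj.1 (hp.2.symm.trans hp'.2))

theorem outCount_lt (n b : ℕ) : outCount o n b < 2 ^ b := by
  have := List.length_filter_le (fun p => decide ((o p []).map List.length = some n)) (shortStrs b)
  have := length_shortStrs b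
  unfold outCount
  omega

/-- Distinct dead values need distinct programs shorter than `r`. -/
theorem deadCount_lt (r B b : ℕ) (x : List Bool) : deadCount o r B b x < 2 ^ r := by
  classical
  unfold deadCount
  rw [card_filter_toFinset List.nodup_range]
  have h : ((List.range B).toFinset.filter fun k => b ≤ k ∧
      ∃ q ∈ shortStrs r, (o q x).map bitsVal = some k) ⊆
      ((shortStrs r).toFinset.image fun q => ((o q x).map bitsVal).getD 0) := by
    intro k hk
    obtain ⟨-, -, q, hq, h⟩ := Finset.mem_filter.1 hk
    exact Finset.mem_image.2 ⟨q, by simpa using hq, by simp [h]⟩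
  have := (Finset.card_le_card h).trans Finset.card_image_le
  rw [List.toFinset_card_of_nodup (nodup_shortStrs r)] at this
  have := length_shortStrs r
  omega

theorem not_heavy_zero (M n j : ℕ) : ¬ Heavy o M n 0 j := by
  have := outCount_lt (o := o) n (M * j + 1)
  simp [Heavy]
  omega

/-- At most `outCount` strings of length `n` have complexity less than `b`. -/
theorem card_below_le (n b : ℕ) (S : Finset (List Bool))
    (hS : ∀ x ∈ S, x.length = n ∧ Below o b [] x) : S.card ≤ outCount o n b := by
  classical
  unfold outCount
  rw [card_filter_toFinset (nodup_shortStrs b)]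
  have h : S ⊆ (((shortStrs b).toFinset.filter fun p => (o p []).map List.length = some n).image
      fun p => (o p []).getD []) := by
    intro x hx
    obtain ⟨hn, p, hp, h⟩ := hS x hx
    exact Finset.mem_image.2 ⟨p, by simp [hp, h, hn], by simp [h]⟩
  exact (Finset.card_le_card h).trans Finset.card_image_le

end Counting

/-! ### The budget of all started games -/

section Budget

variable {o : List Bool → List Bool → Option (List Bool)}

/-- This is a geometric tail whose first term is at most `a / c`. -/
theorem sum_threshold_le {a c : ℝ} (ha : 0 ≤ a) (hc : 0 < c) (L : ℕ) :
    ∑ s ∈ Finset.range L, (if c ≤ a * 2 ^ s then (1 / 2 : ℝ) ^ s else 0) ≤ 2 * a / c := by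
  -- Subtracting the tail still to come makes the induction close.
  suffices h : ∑ s ∈ Finset.range L, (if c ≤ a * 2 ^ s then (1 / 2 : ℝ) ^ s else 0) ≤
      max 0 (2 * a / c - 2 * (1 / 2) ^ L) by
    refine h.trans (max_le (by positivity) ?_)
    have : (0 : ℝ) < (1 / 2) ^ L := by positivity
    linarith
  induction L with
  | zero => simp
  | succ L ih =>
    rw [Finset.sum_range_succ]
    have hp : (0 : ℝ) < (1 / 2) ^ L := by positivity
    split_ifs with h
    · have h1 : (1 / 2 : ℝ) ^ L ≤ a / c := by
        rw [le_div_iff₀ hc, one_div, inv_pow, inv_mul_le_iff₀ (by positivity)]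
        linarith
      have h2 : 2 * a / c = 2 * (a / c) := by ring
      rw [max_eq_right (by linarith)] at ih
      refine le_max_of_le_right ?_
      rw [pow_succ]
      linarith
    · rw [add_zero]
      refine ih.trans (max_le_max le_rfl ?_)
      rw [pow_succ]
      linarith

open Classical in
/-- The total budget of all started games of the block of lengths `2 * M * J ≤ n < 4 * M * J`. -/
theorem sum_active_le {M J : ℕ} (hM : 0 < M) (hJ : 0 < J) (L : ℕ) :
    ∑ n ∈ Finset.Ico (2 * M * J) (4 * M * J), ∑ s ∈ Finset.range L,
      (if Active o M J n s then (1 / 2 : ℝ) ^ s else 0) ≤ 16 := by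
  have hMr : (0 : ℝ) < M := by exact_mod_cast hM
  have hJr : (0 : ℝ) < J := by exact_mod_cast hJ
  -- If heavy rows started the game, at least `J / 2` of the `J` rows pass the test, so the sum with
  -- weight `2 / J` already reaches `(1 / 2) ^ s`.
  have hpt : ∀ n s, (if Active o M J n s then (1 / 2 : ℝ) ^ s else 0) ≤
      (if (4 * M * J : ℝ) ≤ 1 * 2 ^ s then (1 / 2 : ℝ) ^ s else 0) +
      2 / J * ∑ j ∈ Finset.Ico J (2 * J),
        (if (2 : ℝ) ^ (M * j) ≤ outCount o n (M * j + 1) * 2 ^ s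
          then (1 / 2 : ℝ) ^ s else 0) := by
    intro n s
    have hp : (0 : ℝ) < (1 / 2) ^ s := by positivity
    have hsum0 : (0 : ℝ) ≤ 2 / J * ∑ j ∈ Finset.Ico J (2 * J),
        (if (2 : ℝ) ^ (M * j) ≤ outCount o n (M * j + 1) * 2 ^ s
          then (1 / 2 : ℝ) ^ s else 0) :=
      mul_nonneg (by positivity) (Finset.sum_nonneg fun j _ => by split_ifs <;> positivity)
    split_ifs with h h' h'
    · linarith
    · rcases h with h | h
      · have heq : ∀ j, Heavy o M n (s + 1) j ↔
            (2 : ℝ) ^ (M * j) ≤ outCount o n (M * j + 1) * 2 ^ s := by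
          intro j
          rw [Heavy, pow_succ, pow_succ, ← mul_assoc, Nat.mul_le_mul_right_iff (by norm_num)]
          exact_mod_cast Iff.rfl
        have hcard : heavyCount o M J n (s + 1) =
            ((Finset.Ico J (2 * J)).filter fun j =>
              (2 : ℝ) ^ (M * j) ≤ outCount o n (M * j + 1) * 2 ^ s).card := by
          unfold heavyCount
          rw [card_filter_toFinset List.nodup_range]
          congr 1
          ext j
          simp only [List.toFinset_range, Finset.mem_filter, Finset.mem_range, Finset.mem_Ico, heq]
          tauto
        rw [← Finset.sum_filter, Finset.sum_const, ← hcard, nsmul_eq_mul, zero_add]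
        have hr : (J : ℝ) ≤ 2 * heavyCount o M J n (s + 1) := by exact_mod_cast h
        have : (1 : ℝ) ≤ 2 / J * heavyCount o M J n (s + 1) := by
          rw [div_mul_eq_mul_div, le_div_iff₀ hJr]
          linarith
        nlinarith
      · exact absurd (by rw [one_mul]; exact_mod_cast h) h'
    · linarith
    · linarith
  have hN : ∀ j, ∑ n ∈ Finset.Ico (2 * M * J) (4 * M * J), (outCount o n (M * j + 1) : ℝ) ≤
      2 ^ (M * j + 1) := fun j => by exact_mod_cast sum_outCount_le _ _
  calc ∑ n ∈ Finset.Ico (2 * M * J) (4 * M * J), ∑ s ∈ Finset.range L,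
        (if Active o M J n s then (1 / 2 : ℝ) ^ s else 0)
      ≤ ∑ n ∈ Finset.Ico (2 * M * J) (4 * M * J), (2 * 1 / (4 * M * J : ℝ) +
        2 / J * ∑ j ∈ Finset.Ico J (2 * J),
          2 * outCount o n (M * j + 1) / (2 : ℝ) ^ (M * j)) := by
        refine Finset.sum_le_sum fun n _ => (Finset.sum_le_sum fun s _ => hpt n s).trans ?_
        rw [Finset.sum_add_distrib, ← Finset.mul_sum, Finset.sum_comm]
        refine add_le_add (sum_threshold_le zero_le_one (by positivity) L)
          (mul_le_mul_of_nonneg_left (Finset.sum_le_sum fun j _ => ?_) (by positivity))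
        exact sum_threshold_le (Nat.cast_nonneg _) (by positivity) L
    -- The `2 * M * J` lengths contribute `1 / (2 * M * J)` each. In a row, the output counts sum to
    -- at most `2 ^ (M * j + 1)`, which gives `4`.
    _ ≤ 1 + 2 / J * ∑ j ∈ Finset.Ico J (2 * J), 4 := by
        rw [Finset.sum_add_distrib, ← Finset.mul_sum, Finset.sum_comm]
        refine add_le_add ?_ (mul_le_mul_of_nonneg_left (Finset.sum_le_sum fun j _ => ?_)
          (by positivity))
        · rw [Finset.sum_const, Nat.card_Ico, nsmul_eq_mul]
          have : 4 * M * J - 2 * M * J = 2 * M * J := by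
            have : 4 * M * J = 2 * M * J + 2 * M * J := by ring
            omega
          rw [this]
          push_cast
          refine le_of_eq ?_
          field_simp
          norm_num
        · rw [← Finset.sum_div, ← Finset.mul_sum, div_le_iff₀ (by positivity)]
          have := hN j
          rw [pow_succ] at this
          linarith
    _ ≤ 16 := by
        rw [Finset.sum_const, Nat.card_Ico, nsmul_eq_mul]
        have : 2 * J - J = J := by omega
        rw [this]
        have : (2 : ℝ) / J * (J * 4) = 8 := by field_simp; norm_num
        linarith

/-- The descriptions of length `l` suffice for all started games that use them: those for the
constant `d` have row `l + d`. -/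
theorem sum_budget_le (l : ℕ) (T : Finset (ℕ × ℕ × ℕ)) (J : ℕ → ℕ)
    (hT : ∀ k ∈ T, 0 < J k.1 ∧ 2 * (2 * k.1 + 7) * J k.1 ≤ k.2.1 ∧
      k.2.1 < 4 * (2 * k.1 + 7) * J k.1 ∧ k.1 + k.2.2 + 5 ≤ l ∧
      Active o (2 * k.1 + 7) (J k.1) k.2.1 k.2.2) :
    ∑ k ∈ T, 2 ^ (l - (k.1 + k.2.2 + 5)) ≤ 2 ^ l := by
  classical
  let g : ℕ × ℕ × ℕ → ℝ := fun k =>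
    2 ^ l * (1 / 2) ^ (k.1 + 5) * (if Active o (2 * k.1 + 7) (J k.1) k.2.1 k.2.2 then
      (1 / 2 : ℝ) ^ k.2.2 else 0)
  let D : Finset ℕ := (Finset.range l).filter fun d => 0 < J d
  let B : (d : ℕ) → Finset (ℕ × ℕ) := fun d =>
    Finset.Ico (2 * (2 * d + 7) * J d) (4 * (2 * d + 7) * J d) ×ˢ Finset.range l
  have hg0 : ∀ k, 0 ≤ g k := fun k => by simp only [g]; split_ifs <;> positivity
  have hT1 : ((∑ k ∈ T, 2 ^ (l - (k.1 + k.2.2 + 5)) : ℕ) : ℝ) ≤ ∑ k ∈ T, g k := by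
    push_cast
    refine Finset.sum_le_sum fun k hk => ?_
    obtain ⟨-, -, -, h, ha⟩ := hT k hk
    simp only [g, if_pos ha]
    rw [mul_assoc, ← pow_add, pow_sub₀ _ (by norm_num) h, one_div, inv_pow]
    refine le_of_eq ?_
    ring_nf
  have hT2 : ∑ k ∈ T, g k ≤ ∑ d ∈ D, ∑ p ∈ B d, g (d, p) := by
    rw [Finset.sum_sigma' D B (fun d p => g (d, p))]
    have hinj : Set.InjOn (fun k : ℕ × ℕ × ℕ => (⟨k.1, k.2⟩ : (_ : ℕ) × (ℕ × ℕ))) T := by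
      rintro ⟨a, b⟩ - ⟨a', b'⟩ - h
      simpa using h
    rw [← Finset.sum_image (f := fun q : (_ : ℕ) × (ℕ × ℕ) => g (q.1, q.2)) hinj]
    refine Finset.sum_le_sum_of_subset_of_nonneg ?_ fun _ _ _ => hg0 _
    intro q hq
    obtain ⟨k, hk, rfl⟩ := Finset.mem_image.1 hq
    obtain ⟨h1, h2, h3, h4, -⟩ := hT k hk
    simp only [D, B, Finset.mem_sigma, Finset.mem_filter, Finset.mem_range, Finset.mem_product,
      Finset.mem_Ico]
    exact ⟨⟨by omega, h1⟩, ⟨h2, h3⟩, by omega⟩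
  -- For fixed `l`, each `d` plays in one block of lengths only, whose bound `16` turns the weight
  -- `2 ^ (-(d + 5))` into a summable `2 ^ (-(d + 1))`.
  have hT3 : ∀ d ∈ D, ∑ p ∈ B d, g (d, p) ≤ 2 ^ l * (1 / 2) ^ (d + 1) := by
    intro d hd
    have h := sum_active_le (o := o) (M := 2 * d + 7) (by omega) (Finset.mem_filter.1 hd).2 l
    simp only [B, g]
    rw [Finset.sum_product]
    simp only [← Finset.mul_sum]
    · refine (mul_le_mul_of_nonneg_left h (by positivity)).trans (le_of_eq ?_)
      rw [pow_add, pow_add _ d 1]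
      ring
  have hT4 : ∑ d ∈ D, (2 : ℝ) ^ l * (1 / 2) ^ (d + 1) ≤ 2 ^ l := by
    rw [← Finset.mul_sum]
    refine mul_le_of_le_one_right (by positivity) ?_
    calc ∑ d ∈ D, (1 / 2 : ℝ) ^ (d + 1) ≤ ∑ d ∈ Finset.range l, (1 / 2 : ℝ) ^ (d + 1) :=
          Finset.sum_le_sum_of_subset_of_nonneg (Finset.filter_subset _ _)
            fun _ _ _ => by positivity
      _ = (1 / 2) * ∑ d ∈ Finset.range l, (1 / 2 : ℝ) ^ d := by
          rw [Finset.mul_sum]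
          exact Finset.sum_congr rfl fun d _ => by ring
      _ ≤ 1 := by
          have := sum_geometric_two_le l
          linarith
  exact_mod_cast hT1.trans (hT2.trans ((Finset.sum_le_sum hT3).trans hT4))

end Budget

/-! ### Winning the game row by row -/

section Game

variable {o : List Bool → List Bool → Option (List Bool)} {M J n s : ℕ}

theorem lightAbove_two_mul : lightAbove o M J n s (2 * J) = 0 := by
  simp only [lightAbove, List.length_eq_zero_iff, List.filter_eq_nil_iff, List.mem_range,
    decide_eq_true_eq]
  omega

theorem lightAbove_of_heavy {j : ℕ} (h : Heavy o M n s j) :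
    lightAbove o M J n s j = lightAbove o M J n s (j + 1) := by
  unfold lightAbove
  congr 1
  refine List.filter_congr fun i _ => ?_
  rw [decide_eq_decide]
  refine and_congr_left fun hi => ⟨fun hji => ?_, fun hji => by omega⟩
  rcases hji.eq_or_lt with rfl | hlt
  · exact absurd h hi
  · exact hlt

theorem lightAbove_le_succ (j : ℕ) :
    lightAbove o M J n s j ≤ lightAbove o M J n s (j + 1) + 1 := by
  unfold lightAbove
  rw [card_filter_toFinset List.nodup_range, card_filter_toFinset List.nodup_range]
  refine le_trans (Finset.card_le_card (t := insert j _) ?_) (Finset.card_insert_le j _)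
  intro i hi
  simp only [Finset.mem_insert, Finset.mem_filter] at hi ⊢
  rcases hi.2.1.eq_or_lt with rfl | hlt
  · exact Or.inl rfl
  · exact Or.inr ⟨hi.1, hlt, hi.2.2⟩

theorem lightAbove_add_heavyCount :
    lightAbove o M J n s J + heavyCount o M J n s = J := by
  classical
  unfold lightAbove heavyCount
  rw [card_filter_toFinset List.nodup_range, card_filter_toFinset List.nodup_range,
    ← Finset.filter_filter, ← Finset.filter_filter, add_comm,
    Finset.card_filter_add_card_filter_not]
  have : (List.range (2 * J)).toFinset.filter (fun j => J ≤ j) = Finset.Ico J (2 * J) := by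
    ext j; simp; tauto
  rw [this, Nat.card_Ico]
  omega

theorem deadCount_lt_deadCount {r B b b' k : ℕ} {x : List Bool} (hbk : b ≤ k) (hkb : k < b')
    (hkB : k < B) (hk : ∃ q ∈ shortStrs r, (o q x).map bitsVal = some k) :
    deadCount o r B b' x + 1 ≤ deadCount o r B b x := by
  unfold deadCount
  rw [card_filter_toFinset List.nodup_range, card_filter_toFinset List.nodup_range]
  refine Finset.card_lt_card (Finset.ssubset_iff_of_subset ?_ |>.2 ⟨k, ?_, ?_⟩)
  · intro i hi
    simp only [Finset.mem_filter] at hi ⊢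
    exact ⟨hi.1, by omega, hi.2.2⟩
  · simp only [Finset.mem_filter, List.toFinset_range, Finset.mem_range]
    exact ⟨hkB, hbk, hk⟩
  · simp only [Finset.mem_filter]
    omega

/-- If every string of length `n` has a complexity that is simple given the string, and every
light row can be filled with eligible strings, then there are less than `2 ^ r` light rows. -/
theorem lightAbove_lt {r e : ℕ} {C : List Bool → ℕ} (hC : ∀ x b, Below o b [] x ↔ C x < b)
    (hdead : ∀ x : List Bool, x.length = n →
      ∃ q ∈ shortStrs r, (o q x).map bitsVal = some (C x))
    (hM : M = e + 2) (hs : s + e ≤ M * J) (hn : 2 * M * J ≤ n)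
    (hfill : ∀ j, J ≤ j → j < 2 * J → ∀ S : Finset (List Bool),
      (∀ x ∈ S, x.length = n ∧ Eligible o M J r n s j x) → 2 ^ (M * j - (s + e)) ≤ S.card →
      ∃ S' : Finset (List Bool), 2 ^ (M * j - (s + e)) ≤ S'.card ∧ ∀ x ∈ S', x.length = n ∧
        lightAbove o M J n s (j + 1) ≤ deadCount o r (2 * M * J) (M * j + 1) x ∧
        C x ≤ M * j) :
    lightAbove o M J n s J < 2 ^ r := by
  classical
  -- Here `i` counts the rows handled from the top. The threshold `b` varies: the next row uses `b =
  -- M * j + 1` for strings still above it, and the end uses `b = 0`.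
  have key : ∀ i ≤ J, ∃ S : Finset (List Bool), 2 ^ (M * (2 * J - i) - (s + e)) ≤ S.card ∧
      ∀ x ∈ S, x.length = n ∧ ∀ b ≤ M * (2 * J - i), b ≤ C x →
        lightAbove o M J n s (2 * J - i) ≤ deadCount o r (2 * M * J) b x := by
    intro i
    induction i with
    | zero =>
      intro _
      refine ⟨(strs n).toFinset, ?_, fun x hx => ⟨mem_strs.1 (List.mem_toFinset.1 hx), ?_⟩⟩
      · rw [List.toFinset_card_of_nodup (nodup_strs n), length_strs]
        refine Nat.pow_le_pow_right (by norm_num) ((Nat.sub_le _ _).trans (le_trans ?_ hn))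
        exact le_of_eq (by rw [Nat.sub_zero]; ring)
      · intro b _ _
        rw [Nat.sub_zero, lightAbove_two_mul]
        exact Nat.zero_le _
    | succ i ih =>
      intro hi
      obtain ⟨S, hcard, hS⟩ := ih (by omega)
      obtain ⟨j, hj⟩ : ∃ j, 2 * J - (i + 1) = j := ⟨_, rfl⟩
      have hj1 : 2 * J - i = j + 1 := by omega
      rw [hj1] at hcard hS
      rw [hj]
      have hMj : M * (j + 1) = M * j + M := by ring
      have hMJ : M * J ≤ M * j := Nat.mul_le_mul_left _ (by omega)
      have hMJ' : M * (j + 1) ≤ 2 * M * J := by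
        have := Nat.mul_le_mul_left M (show j + 1 ≤ 2 * J by omega)
        have : M * (2 * J) = 2 * M * J := by ring
        omega
      by_cases hh : Heavy o M n s j
      · refine ⟨S, (Nat.pow_le_pow_right (by norm_num) (by omega)).trans hcard, fun x hx =>
          ⟨(hS x hx).1, fun b hb hbC => ?_⟩⟩
        rw [lightAbove_of_heavy hh]
        exact (hS x hx).2 b (by omega) hbC
      -- In a light row `S` has at least `4 * c * 2 ^ e` elements, as `M = e + 2`, and fewer than `2
      -- * c * 2 ^ e` of them have complexity at most `M * j`. At least `c` remain eligible.
      · obtain ⟨c, hc⟩ : ∃ c, 2 ^ (M * j - (s + e)) = c := ⟨_, rfl⟩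
        have hlow : (S.filter fun x => C x < M * j + 1).card ≤ outCount o n (M * j + 1) :=
          card_below_le n _ _ fun x hx =>
            ⟨(hS x (Finset.mem_filter.1 hx).1).1, (hC _ _).2 (Finset.mem_filter.1 hx).2⟩
        have hsplit := Finset.card_filter_add_card_filter_not (s := S)
          (fun x => C x < M * j + 1)
        have hout : outCount o n (M * j + 1) < 2 * c * 2 ^ e := by
          have h : outCount o n (M * j + 1) * 2 ^ s < 2 ^ (M * j + 1) := not_le.1 hh
          have h2 : 2 ^ (M * j + 1) = 2 * c * 2 ^ e * 2 ^ s := by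
            have : M * j + 1 = (M * j - (s + e)) + e + s + 1 := by omega
            rw [this, pow_add, pow_add, pow_add, hc]
            ring
          rw [h2] at h
          exact lt_of_mul_lt_mul_right h (Nat.zero_le _)
        have hbig : 4 * c * 2 ^ e ≤ S.card := by
          refine le_trans (le_of_eq ?_) hcard
          have : M * (j + 1) - (s + e) = (M * j - (s + e)) + e + 2 := by omega
          rw [this, pow_add, pow_add, hc]
          ring
        have hce : c ≤ c * 2 ^ e := Nat.le_mul_of_pos_right _ (by positivity)
        have hfin : c ≤ (S.filter fun x => ¬ C x < M * j + 1).card := by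
          have h1 : 2 * c * 2 ^ e = 2 * (c * 2 ^ e) := by ring
          have h2 : 4 * c * 2 ^ e = 4 * (c * 2 ^ e) := by ring
          omega
        obtain ⟨S', hS'c, hS'⟩ := hfill j (by omega) (by omega)
          (S.filter fun x => ¬ C x < M * j + 1) (fun x hx => by
            obtain ⟨hx, hxC⟩ := Finset.mem_filter.1 hx
            exact ⟨(hS x hx).1, fun h => hxC ((hC _ _).1 h),
              (hS x hx).2 _ (by omega) (not_lt.1 hxC)⟩) (hc ▸ hfin)
        refine ⟨S', hS'c, fun x hx => ?_⟩
        obtain ⟨hxn, hxl, hxC⟩ := hS' x hx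
        refine ⟨hxn, fun b _ hbC => ?_⟩
        -- The new dead value is `C x`, which lies between `b` and `M * j`.
        have h1 := deadCount_lt_deadCount (B := 2 * M * J) hbC (Nat.lt_succ_of_le hxC)
          (by omega) (hdead x hxn)
        have h2 := lightAbove_le_succ (o := o) (M := M) (J := J) (n := n) (s := s) j
        exact h2.trans ((Nat.succ_le_succ hxl).trans h1)
  obtain ⟨S, hcard, hS⟩ := key J le_rfl
  obtain ⟨x, hx⟩ := Finset.card_pos.1 (lt_of_lt_of_le (by positivity) hcard)
  have h := (hS x hx).2 0 (Nat.zero_le _) (Nat.zero_le _)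
  rw [show 2 * J - J = J by omega] at h
  exact h.trans_lt (deadCount_lt _ _ _ _)

/-- Take the least active `s`. If `s` is positive, inactivity of `s - 1` says that fewer than half
of the rows are heavy for `s`; for `s = 0` none is. The second clause of `Active` bounds `s`. -/
theorem exists_active_balanced {r : ℕ} (hJ : J = 2 ^ (r + 1)) :
    ∃ s ≤ r + 3 + M, Active o M J n s ∧ 2 ^ r ≤ lightAbove o M J n s J := by
  classical
  have hex : Active o M J n (r + 3 + M) := by
    right
    calc 4 * M * J ≤ 4 * 2 ^ M * J := by gcongr; exact Nat.lt_two_pow_self.le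
      _ = 2 ^ (r + 3 + M) := by rw [hJ]; ring
  refine ⟨Nat.find ⟨_, hex⟩, Nat.find_min' _ hex, Nat.find_spec ⟨_, hex⟩, ?_⟩
  have hJr : J = 2 * 2 ^ r := by rw [hJ, pow_succ]; ring
  rcases hs : Nat.find ⟨_, hex⟩ with _ | s
  · have h := lightAbove_add_heavyCount (o := o) (M := M) (J := J) (n := n) (s := 0)
    have : heavyCount o M J n 0 = 0 := by
      simp [heavyCount, not_heavy_zero]
    omega
  · have hmin : ¬ Active o M J n s := Nat.find_min ⟨_, hex⟩ (by omega)
    have h := lightAbove_add_heavyCount (o := o) (M := M) (J := J) (n := n) (s := s + 1)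
    unfold Active at hmin
    omega

end Game

/-! ### From stages to the limit -/

theorem plainComplexity_le_iff {U : List Bool → List Bool →. List Bool} {x y : List Bool} {m : ℕ} :
    plainComplexity U x y ≤ m ↔ ∃ p, p.length ≤ m ∧ x ∈ U p y := by
  constructor
  · intro h
    by_contra hne
    push Not at hne
    have : ((m + 1 : ℕ) : ℕ∞) ≤ plainComplexity U x y := by
      refine le_iInf₂ fun p hp => ?_
      have : ¬ p.length ≤ m := fun hle => hne p hle hp
      exact_mod_cast (by omega : m + 1 ≤ p.length)
    have := this.trans h
    norm_cast at this
    omega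
  · rintro ⟨p, hp, hx⟩
    exact (plainComplexity_le hx).trans (by exact_mod_cast hp)

theorem IsOptimalMachine.exists_eq_natCast {U : List Bool → List Bool →. List Bool}
    (hU : IsOptimalMachine U) (x y : List Bool) : ∃ k : ℕ, plainComplexity U x y = k := by
  have hV : Partrec₂ fun (p _ : List Bool) => Part.some p := Computable.fst
  obtain ⟨d, hd⟩ := hU.2 _ hV
  have h : plainComplexity U x y ≤ ((x.length + d : ℕ) : ℕ∞) := by
    refine (hd x y).trans ?_
    push_cast
    gcongr
    exact plainComplexity_le (Part.mem_some x)
  obtain ⟨k, hk⟩ := ENat.ne_top_iff_exists.1 (ne_top_of_le_ne_top (ENat.natCast_ne_top _) h)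
  exact ⟨k, hk.symm⟩

open Classical in
/-- The evaluator with the values of the machine `U`. -/
noncomputable def limitEval (U : List Bool → List Bool →. List Bool) (p y : List Bool) :
    Option (List Bool) :=
  (U p y).toOption

theorem limitEval_eq_some {U : List Bool → List Bool →. List Bool} {p y z : List Bool} :
    limitEval U p y = some z ↔ z ∈ U p y := by
  classical
  exact Part.mem_toOption

theorem below_limitEval_iff {U : List Bool → List Bool →. List Bool} {x y : List Bool} {k b : ℕ}
    (hk : plainComplexity U x y = k) : Below (limitEval U) b y x ↔ k < b := by
  have h : ∀ m : ℕ, k ≤ m ↔ ∃ p, p.length ≤ m ∧ x ∈ U p y := fun m => by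
    rw [← plainComplexity_le_iff, hk, Nat.cast_le]
  rcases b with _ | b
  · simp [Below, shortStrs]
  · rw [Nat.lt_succ_iff, h]
    simp [Below, mem_shortStrs, limitEval_eq_some]

/-- The string `x` is to be given a description of length `l` in the game for strings of length
`n` with budget `2 ^ (-s)` against an opponent with constant `d`, as seen at stage `t`. -/
def Requested (u : ℕ → List Bool → List Bool → Option (List Bool)) (l : ℕ)
    (w : (ℕ × ℕ × ℕ) × List Bool) (t : ℕ) : Prop :=
  let d := w.1.1
  let n := w.1.2.1
  let s := w.1.2.2
  let M := 2 * d + 7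
  -- A `V`-description of length `l = M * j - d` gives `U`-complexity at most `M * j`. Then `j`
  -- determines its block: `J ≤ j < 2 * J`, and `r = Nat.log 2 j - 1`.
  let j := (l + d) / M
  let J := 2 ^ Nat.log 2 j
  (2 * M * J ≤ n ∧ n < 4 * M * J ∧ d + s + 5 ≤ l ∧ Active (u t) M J n s) ∧
    w.2.length = n ∧ Eligible (u t) M J (Nat.log 2 j - 1) n s j w.2

theorem primrecPred_requested {u : ℕ → List Bool → List Bool → Option (List Bool)}
    (hu : Primrec fun a : ℕ × List Bool × List Bool => u a.1 a.2.1 a.2.2) :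
    PrimrecPred fun a : ℕ × ((ℕ × ℕ × ℕ) × List Bool) × ℕ => Requested u a.1 a.2.1 a.2.2 := by
  have hl : Primrec fun a : ℕ × ((ℕ × ℕ × ℕ) × List Bool) × ℕ => a.1 := Primrec.fst
  have ht : Primrec fun a : ℕ × ((ℕ × ℕ × ℕ) × List Bool) × ℕ => a.2.2 :=
    Primrec.snd.comp Primrec.snd
  have hw : Primrec fun a : ℕ × ((ℕ × ℕ × ℕ) × List Bool) × ℕ => a.2.1 :=
    Primrec.fst.comp Primrec.snd
  have hx : Primrec fun a : ℕ × ((ℕ × ℕ × ℕ) × List Bool) × ℕ => a.2.1.2 := Primrec.snd.comp hw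
  have hk : Primrec fun a : ℕ × ((ℕ × ℕ × ℕ) × List Bool) × ℕ => a.2.1.1 := Primrec.fst.comp hw
  have hd : Primrec fun a : ℕ × ((ℕ × ℕ × ℕ) × List Bool) × ℕ => a.2.1.1.1 := Primrec.fst.comp hk
  have hns : Primrec fun a : ℕ × ((ℕ × ℕ × ℕ) × List Bool) × ℕ => a.2.1.1.2 :=
    Primrec.snd.comp hk
  have hn : Primrec fun a : ℕ × ((ℕ × ℕ × ℕ) × List Bool) × ℕ => a.2.1.1.2.1 :=
    Primrec.fst.comp hns
  have hs : Primrec fun a : ℕ × ((ℕ × ℕ × ℕ) × List Bool) × ℕ => a.2.1.1.2.2 :=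
    Primrec.snd.comp hns
  have hM : Primrec fun a : ℕ × ((ℕ × ℕ × ℕ) × List Bool) × ℕ => 2 * a.2.1.1.1 + 7 :=
    Primrec.nat_add.comp (Primrec.nat_mul.comp (Primrec.const 2) hd) (Primrec.const 7)
  have hj := Primrec.nat_div.comp (Primrec.nat_add.comp hl hd) hM
  have hlog := primrec_log2.comp hj
  have hJ := primrec_nat_pow.comp (Primrec.const 2) hlog
  have hr := Primrec.nat_sub.comp hlog (Primrec.const 1)
  refine PrimrecPred.and (PrimrecPred.and ?_ (PrimrecPred.and ?_ (PrimrecPred.and ?_ ?_)))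
    (PrimrecPred.and ?_ ?_)
  · exact Primrec.nat_le.comp
      (Primrec.nat_mul.comp (Primrec.nat_mul.comp (Primrec.const 2) hM) hJ) hn
  · exact Primrec.nat_lt.comp hn
      (Primrec.nat_mul.comp (Primrec.nat_mul.comp (Primrec.const 4) hM) hJ)
  · exact Primrec.nat_le.comp (Primrec.nat_add.comp (Primrec.nat_add.comp hd hs)
      (Primrec.const 5)) hl
  · exact primrecPred_active hu ht hM hJ hn hs
  · exact Primrec.eq.comp (Primrec.list_length.comp hx) hn
  · exact primrecPred_eligible hu ht hM hJ hr hn hs hj hx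

section Stages

variable {U : List Bool → List Bool →. List Bool}
  {u : ℕ → List Bool → List Bool → Option (List Bool)}

theorem exists_stage (hmono : ∀ t t' p y z, t ≤ t' → u t p y = some z → u t' p y = some z)
    (hspec : ∀ p y z, z ∈ U p y ↔ ∃ t, u t p y = some z) (b : ℕ) (x y : List Bool) :
    ∃ t, ∀ p z, p.length < b → (limitEval U p x = some z → u t p x = some z) ∧
      (limitEval U p y = some z → u t p y = some z) := by
  have h1 : ∀ p y, ∀ᶠ t in Filter.atTop, ∀ z, limitEval U p y = some z → u t p y = some z := by
    intro p y
    rcases h : limitEval U p y with _ | z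
    · simp
    · obtain ⟨t, ht⟩ := (hspec _ _ _).1 (limitEval_eq_some.1 h)
      filter_upwards [Filter.eventually_ge_atTop t] with t' ht' z' hz'
      rw [← hz']
      exact hmono _ _ _ _ _ ht' ht
  have h2 : ∀ p ∈ (shortStrs b).toFinset, ∀ᶠ t in Filter.atTop, ∀ z,
      (limitEval U p x = some z → u t p x = some z) ∧
      (limitEval U p y = some z → u t p y = some z) := fun p _ => by
    filter_upwards [h1 p x, h1 p y] with t hx hy z
    exact ⟨hx z, hy z⟩
  obtain ⟨t, ht⟩ := ((Filter.eventually_all_finset _).2 h2).exists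
  exact ⟨t, fun p z hp => ht p (List.mem_toFinset.2 (mem_shortStrs.2 hp)) z⟩

theorem limitEval_of_stage (hspec : ∀ p y z, z ∈ U p y ↔ ∃ t, u t p y = some z) {t : ℕ}
    {p y z : List Bool} (h : u t p y = some z) : limitEval U p y = some z :=
  limitEval_eq_some.2 ((hspec _ _ _).2 ⟨t, h⟩)

/-- Only finitely many programs matter, so some stage has already seen all their halting
computations. -/
theorem exists_stage_active_eligible
    (hmono : ∀ t t' p y z, t ≤ t' → u t p y = some z → u t' p y = some z)
    (hspec : ∀ p y z, z ∈ U p y ↔ ∃ t, u t p y = some z) {M J r n s j : ℕ} {x : List Bool}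
    (ha : Active (limitEval U) M J n s) (he : Eligible (limitEval U) M J r n s j x) :
    ∃ t, Active (u t) M J n s ∧ Eligible (u t) M J r n s j x := by
  obtain ⟨t, ht⟩ := exists_stage hmono hspec (2 * M * J + 1 + r) [] x
  have h1 : ∀ p z, p.length < 2 * M * J + 1 → limitEval U p [] = some z → u t p [] = some z :=
    fun p z hp => (ht p z (by omega)).1
  refine ⟨t, ha.mono h1, fun ⟨p, hp, h⟩ => he.1 ⟨p, hp, limitEval_of_stage hspec h⟩, ?_⟩
  · exact (lightAbove_anti h1 n s (j + 1)).trans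
      (he.2.trans (deadCount_mono (fun p z hp => (ht p z (by omega)).2) _ _))

end Stages

/-! ### The contradiction and the theorem -/

theorem IsOptimalMachine.exists_complexity_not_simple {U : List Bool → List Bool →. List Bool}
    (hU : IsOptimalMachine U) : ∃ M : ℕ, 0 < M ∧ ∀ r n : ℕ, 1 ≤ r →
      2 * M * 2 ^ (r + 1) ≤ n → n < 4 * M * 2 ^ (r + 1) →
      ∃ x : List Bool, x.length = n ∧ ∃ k : ℕ, plainComplexity U x [] = k ∧
        ∀ q, Nat.bits k ∈ U q x → r ≤ q.length := by
  classical
  obtain ⟨u, hu, hmono, hspec⟩ := exists_stepwise_evaluator hU.1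
  obtain ⟨V, hV, hVspec⟩ := exists_machine_of_capped
    (cap := fun l k => 2 ^ (l - (k.1 + k.2.2 + 5))) (primrecPred_requested hu)
    (primrec_nat_pow.comp (Primrec.const 2) (Primrec.nat_sub.comp Primrec.fst
      (Primrec.nat_add.comp (Primrec.nat_add.comp (Primrec.fst.comp Primrec.snd)
        (Primrec.snd.comp (Primrec.snd.comp Primrec.snd))) (Primrec.const 5))))
    (fun l T hT => by
      refine sum_budget_le (o := limitEval U) l T
        (fun d => 2 ^ Nat.log 2 ((l + d) / (2 * d + 7))) fun k hk => ?_
      obtain ⟨x, t, ⟨h1, h2, h3, h4⟩, -⟩ := hT k hk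
      exact ⟨by positivity, h1, h2, h3,
        h4.mono fun p z _ h => limitEval_of_stage hspec h⟩)
  obtain ⟨d, hd⟩ := hU.2 V hV
  choose C hC using fun x => hU.exists_eq_natCast x []
  obtain ⟨M, hM⟩ : ∃ M, 2 * d + 7 = M := ⟨_, rfl⟩
  refine ⟨M, by omega, fun r n hr hn hn' => ?_⟩
  obtain ⟨J, hJ⟩ : ∃ J, 2 ^ (r + 1) = J := ⟨_, rfl⟩
  rw [hJ] at hn hn'
  by_contra! hcon
  obtain ⟨s, hs, hact, hlight⟩ :=
    exists_active_balanced (o := limitEval U) (M := M) (n := n) hJ.symm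
  have hsJ : s + (2 * d + 5) ≤ M * J := by
    have h2 : r + 3 ≤ J := by
      rw [← hJ]
      clear hs hlight hact hcon hn hn' hJ
      induction r, hr using Nat.le_induction with
      | base => norm_num
      | succ r hr ih => rw [pow_succ]; omega
    have hJ4 : 4 ≤ J := by omega
    nlinarith
  refine absurd hlight (not_le.2 (lightAbove_lt (r := r) (e := 2 * d + 5)
    (fun x b => below_limitEval_iff (hC x)) ?_ (by omega) hsJ hn ?_))
  · intro x hx
    obtain ⟨q, hq, hlt⟩ := hcon x hx (C x) (hC x)
    exact ⟨q, mem_shortStrs.2 hlt, by rw [limitEval_eq_some.2 hq, Option.map_some, bitsVal_bits]⟩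
  · intro j hj hj2 S hS hcard
    have hMj : M * J ≤ M * j := Nat.mul_le_mul_left _ hj
    have hrow : (M * j - d + d) / M = j := by
      rw [Nat.sub_add_cancel (by omega), Nat.mul_div_cancel_left _ (by omega)]
    have hlog : Nat.log 2 j = r + 1 := by
      refine Nat.log_eq_of_pow_le_of_lt_pow (by omega) ?_
      rw [pow_succ]
      omega
    -- The loss `2 * d + 5` is `d` for translating `V` into `U` plus `d + 5` for the weight of `d`.
    have hcap : M * j - d - (d + s + 5) = M * j - (s + (2 * d + 5)) := by omega
    obtain ⟨S', hS'c, hS'⟩ := hVspec (M * j - d) (d, n, s) S (fun x hx => by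
      obtain ⟨t, ht, ht'⟩ := exists_stage_active_eligible hmono hspec hact (hS x hx).2
      refine ⟨t, ?_⟩
      simp only [Requested, hrow, hlog, hM, hJ, Nat.add_sub_cancel]
      exact ⟨⟨hn, hn', by omega, ht⟩, (hS x hx).1, ht'⟩) (by simpa only [hcap] using hcard)
    refine ⟨S', by simpa only [hcap] using hS'c, fun x hx => ?_⟩
    obtain ⟨⟨t, ht⟩, hxV⟩ := hS' x hx
    simp only [Requested, hrow, hlog, hM, hJ, Nat.add_sub_cancel] at ht
    refine ⟨ht.2.1, ?_, ?_⟩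
    -- The request was made at a finite stage; in the limit light rows only disappear and dead
    -- values only appear, so the inequality survives.
    · exact (lightAbove_anti (fun p z _ h => limitEval_of_stage hspec h) _ _ _).trans
        (ht.2.2.2.trans (deadCount_mono (fun p z _ h => limitEval_of_stage hspec h) _ _))
    · have h := (hd x []).trans (add_le_add_left (hxV []) _)
      rw [hC x] at h
      norm_cast at h
      omega

theorem theorem1 (U : List Bool → List Bool →. List Bool) (hU : IsOptimalMachine U) :
    ∃ c : ℕ, ∀ n : ℕ, ∃ x : List Bool, x.length = n ∧
      ∃ k m : ℕ, plainComplexity U x [] = (k : ℕ∞) ∧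
        plainComplexity U (Nat.bits k) x = (m : ℕ∞) ∧
          Real.logb 2 (n : ℝ) - (c : ℝ) ≤ (m : ℝ) := by
  obtain ⟨M, hM, h⟩ := hU.exists_complexity_not_simple
  -- For `n < 8 * M` the bound is trivial; otherwise `n < 2 ^ (r + 1) * (8 * M)` with `r + 1 ≤ m`,
  -- and `8 * M ≤ 2 ^ (8 * M)`.
  refine ⟨8 * M, fun n => ?_⟩
  have hlog : ∀ a m : ℕ, a < 2 ^ m → Real.logb 2 (a : ℝ) ≤ m := fun a m ha => by
    rcases Nat.eq_zero_or_pos a with rfl | h0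
    · simp
    · rw [Real.logb_le_iff_le_rpow (by norm_num) (by exact_mod_cast h0), Real.rpow_natCast]
      exact_mod_cast ha.le
  by_cases hn : n < 8 * M
  · obtain ⟨k, hk⟩ := hU.exists_eq_natCast (List.replicate n false) []
    obtain ⟨m, hm⟩ := hU.exists_eq_natCast (Nat.bits k) (List.replicate n false)
    refine ⟨List.replicate n false, List.length_replicate, k, m, hk, hm, ?_⟩
    have := hlog n (8 * M) (hn.trans Nat.lt_two_pow_self)
    have : (0 : ℝ) ≤ m := Nat.cast_nonneg m
    linarith
  · have hdiv : 4 ≤ n / (2 * M) := by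
      rw [Nat.le_div_iff_mul_le (by omega)]
      omega
    obtain ⟨r, hr⟩ : ∃ r, Nat.log 2 (n / (2 * M)) = r + 1 + 1 := by
      have : 2 ≤ Nat.log 2 (n / (2 * M)) := Nat.le_log_of_pow_le (by norm_num) hdiv
      exact ⟨Nat.log 2 (n / (2 * M)) - 2, by omega⟩
    have h1 : 2 ^ (r + 1 + 1) ≤ n / (2 * M) := hr ▸ Nat.pow_log_le_self 2 (by omega)
    have h2 : n / (2 * M) < 2 ^ (r + 1 + 1 + 1) := by
      have := Nat.lt_pow_succ_log_self (b := 2) (by norm_num) (n / (2 * M))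
      rwa [hr] at this
    rw [Nat.le_div_iff_mul_le (by omega)] at h1
    rw [Nat.div_lt_iff_lt_mul (by omega)] at h2
    have h3 : n < 4 * M * 2 ^ (r + 1 + 1) := by
      calc n < 2 ^ (r + 1 + 1 + 1) * (2 * M) := h2
        _ = 4 * M * 2 ^ (r + 1 + 1) := by ring
    obtain ⟨x, hx, k, hk, hq⟩ := h (r + 1) n (by omega) (by rw [mul_comm]; exact h1) h3
    obtain ⟨m, hm⟩ := hU.exists_eq_natCast (Nat.bits k) x
    refine ⟨x, hx, k, m, hk, hm, ?_⟩
    obtain ⟨q, hqm, hqx⟩ := plainComplexity_le_iff.1 hm.le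
    have hrm : r + 1 ≤ m := (hq q hqx).trans hqm
    have h4 : n < 2 ^ (m + 8 * M) := by
      calc n < 4 * M * 2 ^ (r + 1 + 1) := h3
        _ = 2 ^ (r + 1) * (8 * M) := by ring
        _ ≤ 2 ^ m * 2 ^ (8 * M) := by
            gcongr
            · norm_num
            · exact Nat.lt_two_pow_self.le
        _ = 2 ^ (m + 8 * M) := by rw [pow_add]
    have := hlog n _ h4
    push_cast at this ⊢
    linarith
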